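/- Let $(q_k)_{k\ge 1}$ be a strictly increasing sequence of positive integers and let $(\alpha_k)_{k\ge 1}$ be a sequence of positive real numbers. For each $k\ge 1$ let $a_k\in(\mathbb{Z}/q_k\mathbb{Z})^{\times}$, let $G_k$ be a subgroup of $(\mathbb{Z}/q_k\mathbb{Z})^{\times}$, and let $a_kG_k=\{a_kg : g\in G_k\}$ be the coset of $a_k$. Write $\varphi$ for Euler's totient function and $|G_k|$ for the cardinality of $G_k$. Assume that (a) $\sum_{k=1}^{\infty}\alpha_k=+\infty$; (b) there is a real number $c>0$ such that $\sum_{k=1}^{n}\alpha_k\frac{|G_k|}{q_k}>c\sum_{k=1}^{n}\alpha_k$ for infinitely many positive integers $n$; (c) there is a real number $\epsilon>0$ such that $\frac{\varphi(q_k)}{q_k^{1/2-\epsilon}\,|G_k|}\longrightarrow 0$ as $k\to\infty$. Then for almost every $x\in\mathbb{R}$ (with respect to Lebesgue measure) there are infinitely many $k\ge 1$ for which there exists an integer $p_k$, coprime to $q_k$, such that $$\left|x-\frac{p_k}{q_k}\right|<\frac{\alpha_k}{q_k}\quad\text{and}\quad p_k \bmod q_k\in a_kG_k.$$ -/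

import Mathlib

open Filter
open scoped Topology Pointwise

/-!
No zero-one law is needed: instead of bounding the measure of a limsup set from below and
upgrading, weak convergence in `L²` of the circle `ℝ / ℤ` gives full measure at once.

Let `F k` count the `u ∈ a k • G k` for which `x` is within `α k / (2 * q k)` of `u / q k` modulo
`1`, and let `S n = ∑ k < n, F k`, with mean `W n`. Three facts are used.

* Equidistribution. For a fixed frequency `h ≠ 0` the sum of `e(hu / q)` over a coset of `G` is at
  most `√(|h| q)` in absolute value (`norm_sq_sum_cosetResidues_le`), by Parseval's identity and
  invariance under `G`. Together with `φ(q) ≫ q ^ (1 - ε)`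
  (`exists_rpow_one_sub_le_mul_totient`), the hypothesis `hsize` makes this `o(|G k|)`, so the `h`-th
  Fourier coefficient of `S n` is `o(W n)`.
* Second moments. As the fractions `u / q k` are reduced and the `q k` are distinct, two such
  fractions with different `k` never coincide, and `∫ F k * F l ≤ 2 * α k * α l` for `k ≠ l`
  (`card_le_of_norm_toAddCircle_sub_le`, `integral_nearCount_mul_nearCount_le`). Hence
  `∫ (S n) ^ 2 = O((∑ k < n, α k) ^ 2)`, which by `hdens` is `O((W n) ^ 2)` for infinitely many `n`.
* Consequently `S n / W n` tends weakly to `1` along these `n`. On `B = {x | ∀ n, S n x ≤ M}` it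
  tends uniformly to `0`, so testing against the indicator function of `B` shows that `B` is null
  (`ae_forall_exists_lt_of_tendsto_fourier`).

So `S n x` is unbounded for almost every `x`, and as each `F k` is bounded, infinitely many of the
`F k x` are nonzero. This presupposes that the arcs eventually do not cover the circle; if
`q k < α k` for infinitely many `k`, every `x` is well approximated for all those `k`.
-/

/-! ### A lower bound for Euler's totient -/

/-- `φ(n) ≫ n ^ (1 - ε)`. In `n ^ ε * φ(n) / n ≥ ∏ p ^ ε * (1 - 1 / p)`, over the primes `p ∣ n`,
only the boundedly many primes with `p ^ ε < 2` can contribute a factor below `1`, and such a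
factor is at least `1 / 2`. -/
theorem exists_rpow_one_sub_le_mul_totient {ε : ℝ} (hε : 0 < ε) :
    ∃ C : ℝ, 0 < C ∧ ∀ n : ℕ, 0 < n → (n : ℝ) ^ (1 - ε) ≤ C * (n.totient : ℝ) := by
  obtain ⟨B, hB⟩ : ∃ B : ℕ, ∀ p : ℕ, B ≤ p → (2 : ℝ) ≤ (p : ℝ) ^ ε := by
    have := ((tendsto_rpow_atTop hε).comp tendsto_natCast_atTop_atTop).eventually_ge_atTop 2
    exact eventually_atTop.mp this
  refine ⟨2 ^ B, by positivity, fun n hn => ?_⟩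
  have hn' : (0 : ℝ) < n := by exact_mod_cast hn
  have htot : (n.totient : ℝ) = n * ∏ p ∈ n.primeFactors, (1 - (p : ℝ)⁻¹) := by
    have := congrArg (fun x : ℚ => (x : ℝ)) (Nat.totient_eq_mul_prod_factors n)
    push_cast at this
    exact this
  have hrad : ∏ p ∈ n.primeFactors, (p : ℝ) ^ ε ≤ (n : ℝ) ^ ε := by
    rw [Real.finsetProd_rpow _ _ (fun p _ => by positivity)]
    refine Real.rpow_le_rpow (by positivity) ?_ hε.le
    rw [← Nat.cast_prod]
    exact_mod_cast Nat.le_of_dvd hn (Nat.prod_primeFactors_dvd n)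
  have hfac : ∀ p ∈ n.primeFactors,
      (if p < B then (1 / 2 : ℝ) else 1) ≤ (p : ℝ) ^ ε * (1 - (p : ℝ)⁻¹) := by
    intro p hp
    have hp2 : (2 : ℝ) ≤ p := by exact_mod_cast (Nat.prime_of_mem_primeFactors hp).two_le
    have hinv : (p : ℝ)⁻¹ ≤ 1 / 2 := by
      rw [inv_eq_one_div]; exact one_div_le_one_div_of_le (by norm_num) hp2
    split_ifs with h
    · have : (1 : ℝ) ≤ (p : ℝ) ^ ε := Real.one_le_rpow (by linarith) hε.le
      nlinarith
    · have := hB p (not_lt.mp h)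
      nlinarith
  have hlow : (1 / 2 : ℝ) ^ B ≤ ∏ p ∈ n.primeFactors, (if p < B then (1 / 2 : ℝ) else 1) := by
    rw [Finset.prod_ite, Finset.prod_const, Finset.prod_const_one, mul_one]
    refine pow_le_pow_of_le_one (by norm_num) (by norm_num) ?_
    calc _ ≤ (Finset.range B).card := Finset.card_le_card fun p hp => by
          simpa using (Finset.mem_filter.mp hp).2
      _ = B := Finset.card_range B
  have hmain : (1 / 2 : ℝ) ^ B ≤ (n : ℝ) ^ ε * ∏ p ∈ n.primeFactors, (1 - (p : ℝ)⁻¹) := by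
    calc (1 / 2 : ℝ) ^ B ≤ ∏ p ∈ n.primeFactors, ((p : ℝ) ^ ε * (1 - (p : ℝ)⁻¹)) :=
          hlow.trans (Finset.prod_le_prod (fun p _ => by split_ifs <;> norm_num) hfac)
      _ = (∏ p ∈ n.primeFactors, (p : ℝ) ^ ε) * ∏ p ∈ n.primeFactors, (1 - (p : ℝ)⁻¹) :=
          Finset.prod_mul_distrib
      _ ≤ _ := by
          refine mul_le_mul_of_nonneg_right hrad (Finset.prod_nonneg fun p hp => ?_)
          have : (1 : ℝ) ≤ p := by exact_mod_cast (Nat.prime_of_mem_primeFactors hp).one_le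
          exact sub_nonneg.mpr (inv_le_one_of_one_le₀ this)
  have hpow : (n : ℝ) = (n : ℝ) ^ (1 - ε) * (n : ℝ) ^ ε := by
    rw [← Real.rpow_add hn']; simp
  have h2 : (2 : ℝ) ^ B * (1 / 2) ^ B = 1 := by rw [← mul_pow]; norm_num
  calc (n : ℝ) ^ (1 - ε) = (n : ℝ) ^ (1 - ε) * (2 ^ B * (1 / 2) ^ B) := by rw [h2, mul_one]
    _ ≤ (n : ℝ) ^ (1 - ε) *
        (2 ^ B * ((n : ℝ) ^ ε * ∏ p ∈ n.primeFactors, (1 - (p : ℝ)⁻¹))) := by gcongr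
    _ = 2 ^ B * (((n : ℝ) ^ (1 - ε) * (n : ℝ) ^ ε) * ∏ p ∈ n.primeFactors, (1 - (p : ℝ)⁻¹)) := by
        ring
    _ = 2 ^ B * (n.totient : ℝ) := by rw [← hpow, htot]

/-! ### Exponential sums over cosets of subgroups of `(ZMod q)ˣ` -/

section Coset
variable {q : ℕ}

/-- The coset `aG`, as a finite set of residues modulo `q`, not of units: only as residues do its
elements have a position `u / q` on the circle. -/
noncomputable def cosetResidues (a : (ZMod q)ˣ) (G : Subgroup (ZMod q)ˣ) : Finset (ZMod q) :=
  (Set.toFinite ((fun u : (ZMod q)ˣ => (u : ZMod q)) '' (a • (G : Set (ZMod q)ˣ)))).toFinset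

theorem mem_cosetResidues {a : (ZMod q)ˣ} {G : Subgroup (ZMod q)ˣ} {x : ZMod q} :
    x ∈ cosetResidues a G ↔ ∃ u ∈ a • (G : Set (ZMod q)ˣ), (u : ZMod q) = x := by
  simp [cosetResidues]

theorem card_cosetResidues (a : (ZMod q)ˣ) (G : Subgroup (ZMod q)ˣ) :
    (cosetResidues a G).card = Nat.card G := by
  rw [← Set.ncard_coe_finset, cosetResidues, Set.Finite.coe_toFinset, Set.ncard_image_of_injective _ Units.val_injective]
  change (((a * ·) : (ZMod q)ˣ → _) '' (G : Set (ZMod q)ˣ)).ncard = _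
  rw [Set.ncard_image_of_injective _ (mul_right_injective a)]
  rfl

theorem mul_mem_cosetResidues {a : (ZMod q)ˣ} {G : Subgroup (ZMod q)ˣ} {g : (ZMod q)ˣ}
    (hg : g ∈ G) {x : ZMod q} (hx : x ∈ cosetResidues a G) :
    (g : ZMod q) * x ∈ cosetResidues a G := by
  rw [mem_cosetResidues] at hx ⊢
  obtain ⟨u, hu, rfl⟩ := hx
  obtain ⟨g', hg', rfl⟩ := Set.mem_smul_set.mp hu
  refine ⟨g * (a • g'), Set.mem_smul_set.mpr ⟨g * g', G.mul_mem hg hg', ?_⟩, by simp⟩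
  simp only [smul_eq_mul]
  exact mul_left_comm _ _ _

theorem sum_cosetResidues_mul {a : (ZMod q)ˣ} {G : Subgroup (ZMod q)ˣ} {g : (ZMod q)ˣ}
    (hg : g ∈ G) (f : ZMod q → ℂ) :
    ∑ x ∈ cosetResidues a G, f (g * x) = ∑ x ∈ cosetResidues a G, f x := by
  refine Finset.sum_nbij' (fun x => (g : ZMod q) * x) (fun x => ((g⁻¹ : (ZMod q)ˣ) : ZMod q) * x)
    (fun x hx => mul_mem_cosetResidues hg hx)
    (fun x hx => mul_mem_cosetResidues (G.inv_mem hg) hx) ?_ ?_ ?_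
  · intro x _; simp
  · intro x _; simp
  · intro x _; rfl

/-- Parseval's identity for the indicator function of `A`. -/
theorem sum_norm_sq_sum_stdAddChar [NeZero q] (A : Finset (ZMod q)) :
    ∑ t : ZMod q, ‖∑ x ∈ A, ZMod.stdAddChar (t * x)‖ ^ 2 = q * A.card := by
  have key : ((∑ t : ZMod q, ‖∑ x ∈ A, ZMod.stdAddChar (t * x)‖ ^ 2 : ℝ) : ℂ) = q * A.card := by
    push_cast
    have h1 : ∀ t : ZMod q, ((‖∑ x ∈ A, ZMod.stdAddChar (t * x)‖ : ℂ)) ^ 2 =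
        ∑ x ∈ A, ∑ y ∈ A, ZMod.stdAddChar (t * (x - y)) := by
      intro t
      rw [← Complex.mul_conj', map_sum, Finset.sum_mul_sum]
      refine Finset.sum_congr rfl fun x _ => Finset.sum_congr rfl fun y _ => ?_
      rw [← AddChar.map_neg_eq_conj, ← AddChar.map_add_eq_mul]
      congr 1; ring
    simp_rw [h1]
    rw [Finset.sum_comm]
    have h2 : ∀ x ∈ A, ∑ t : ZMod q, ∑ y ∈ A, (ZMod.stdAddChar (t * (x - y)) : ℂ) = q := by
      intro x hx
      rw [Finset.sum_comm]
      simp_rw [AddChar.sum_mulShift _ (ZMod.isPrimitive_stdAddChar q), sub_eq_zero]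
      simp [Finset.sum_ite_eq, hx, ZMod.card]
    rw [Finset.sum_congr rfl h2, Finset.sum_const, nsmul_eq_mul, mul_comm]
  exact_mod_cast key

/-- The square of the sum `S(h) = ∑ e(hx / q)` over a coset of `G` is at most `|h| q`: `S` takes the
same value at all the points `hg`, `g ∈ G`, of which each is repeated at most `gcd(h, q) ≤ |h|`
times, while the sum of `|S|²` over all frequencies is `q |G|`. -/
theorem norm_sq_sum_cosetResidues_le [NeZero q] (a : (ZMod q)ˣ) (G : Subgroup (ZMod q)ˣ) {h : ℤ}
    (hh : h ≠ 0) :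
    ‖∑ x ∈ cosetResidues a G, ZMod.stdAddChar ((h : ZMod q) * x)‖ ^ 2 ≤ |(h : ℝ)| * q := by
  classical
  set S : ZMod q → ℂ := fun t => ∑ x ∈ cosetResidues a G, ZMod.stdAddChar (t * x) with hS
  -- `hg = hg₀` forces `g - g₀` into the `h`-torsion of a cyclic group, of order at most `|h|`
  have hfib : ∀ t : ZMod q, (Finset.univ.filter fun g : G => (h : ZMod q) * (g : (ZMod q)ˣ) = t).card
      ≤ h.natAbs := by
    intro t
    rcases (Finset.univ.filter fun g : G => (h : ZMod q) * (g : (ZMod q)ˣ) = t).eq_empty_or_nonempty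
      with he | ⟨g₀, hg₀⟩
    · simp [he]
    refine le_trans (Finset.card_le_card_of_injOn (t := Finset.univ.filter
      fun y : ZMod q => h.natAbs • y = 0)
      (fun g => (g : (ZMod q)ˣ) - (g₀ : (ZMod q)ˣ) : G → ZMod q) ?_ ?_)
      (IsAddCyclic.card_nsmul_eq_zero_le (Int.natAbs_pos.mpr hh))
    · intro g hg
      simp only [Finset.coe_filter, Finset.mem_univ, true_and, Set.mem_ofPred_eq,
        Finset.mem_filter] at hg hg₀ ⊢
      have h0 : (h : ZMod q) * ((g : (ZMod q)ˣ) - (g₀ : (ZMod q)ˣ) : ZMod q) = 0 := by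
        rw [mul_sub, hg, hg₀, sub_self]
      rw [← zsmul_eq_mul] at h0
      rcases Int.natAbs_eq h with e | e
      · rw [e, natCast_zsmul] at h0; exact h0
      · rw [e, neg_smul, natCast_zsmul, neg_eq_zero] at h0; exact h0
    · intro g _ g' _ hgg
      exact Subtype.ext (Units.ext (sub_left_injective hgg))
  have hinv : ∀ g : G, S ((h : ZMod q) * (g : (ZMod q)ˣ)) = S h := by
    intro g
    simp only [hS, mul_assoc]
    exact sum_cosetResidues_mul g.2 fun x => ZMod.stdAddChar ((h : ZMod q) * x)
  have hG : (0 : ℝ) < Nat.card G := by exact_mod_cast Nat.card_pos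
  have h1 : (Nat.card G : ℝ) * ‖S h‖ ^ 2 = ∑ g : G, ‖S ((h : ZMod q) * (g : (ZMod q)ˣ))‖ ^ 2 := by
    simp_rw [hinv]
    rw [Finset.sum_const, Finset.card_univ, nsmul_eq_mul, Nat.card_eq_fintype_card]
  have h2 : ∑ g : G, ‖S ((h : ZMod q) * (g : (ZMod q)ˣ))‖ ^ 2
      ≤ h.natAbs * ∑ t : ZMod q, ‖S t‖ ^ 2 := by
    rw [← Finset.sum_fiberwise_of_maps_to (t := Finset.univ)
      (g := fun g : G => (h : ZMod q) * (g : (ZMod q)ˣ)) (fun _ _ => Finset.mem_univ _),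
      Finset.mul_sum]
    refine Finset.sum_le_sum fun t _ => ?_
    rw [Finset.sum_congr rfl (g := fun _ => ‖S t‖ ^ 2) (fun g hg => by
      rw [(Finset.mem_filter.mp hg).2]), Finset.sum_const, nsmul_eq_mul]
    gcongr
    exact hfib t
  rw [← h1, sum_norm_sq_sum_stdAddChar, card_cosetResidues, Nat.cast_natAbs, Int.cast_abs] at h2
  have h3 : (Nat.card G : ℝ) * ‖S h‖ ^ 2 ≤ Nat.card G * (|(h : ℝ)| * q) := by linarith
  exact le_of_mul_le_mul_left h3 hG

end Coset

/-! ### Counting close pairs of fractions -/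

/-- Among the pairs of fractions with denominators `q` and `r`, at most `2εqr` are distinct modulo
`1` and at distance at most `ε`. There is no error term because coincident pairs are excluded: the
differences form a finite subgroup of the circle, of order `N` say, hence consist of multiples of
`1 / N`, and at most `2εN` nonzero ones are within `ε` of `0`; each difference arises from `qr / N`
pairs. -/
theorem card_le_of_norm_toAddCircle_sub_le {q r : ℕ} [NeZero q] [NeZero r]
    (P : Finset (ZMod q × ZMod r)) {ε : ℝ} (hε : 0 ≤ ε)
    (hne : ∀ x ∈ P, ZMod.toAddCircle x.1 ≠ ZMod.toAddCircle x.2)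
    (hle : ∀ x ∈ P, ‖ZMod.toAddCircle x.1 - ZMod.toAddCircle x.2‖ ≤ ε) :
    (P.card : ℝ) ≤ 2 * ε * (q * r) := by
  classical
  let φ : ZMod q × ZMod r →+ UnitAddCircle :=
    (ZMod.toAddCircle (N := q)).coprod (-ZMod.toAddCircle (N := r))
  have hφ : ∀ x, φ x = ZMod.toAddCircle x.1 - ZMod.toAddCircle x.2 := fun x => by
    simp [φ, sub_eq_add_neg]
  have hNK : Nat.card φ.ker * Nat.card φ.range = q * r := by
    rw [← AddSubgroup.index_ker, AddSubgroup.card_mul_index]; simp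
  have : Finite φ.range := Set.finite_range φ
  set N := Nat.card φ.range with hN
  have hN0 : 0 < N := Nat.card_pos
  have hN0' : (0 : ℝ) < N := by exact_mod_cast hN0
  have hfib : ∀ y ∈ P.image φ, (P.filter fun x => φ x = y).card ≤ Nat.card φ.ker := by
    intro y hy
    obtain ⟨x₀, hx₀, rfl⟩ := Finset.mem_image.mp hy
    rw [← Nat.card_eq_finsetCard]
    refine Nat.card_le_card_of_injective
      (fun x => (⟨x.1 - x₀, ?_⟩ : φ.ker)) ?_
    · rw [AddMonoidHom.mem_ker, map_sub, (Finset.mem_filter.mp x.2).2, sub_self]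
    · intro x x' hxx
      exact Subtype.ext (sub_left_injective (congrArg Subtype.val hxx))
  set m : ℕ := ⌊ε * N⌋₊ with hm
  have himg : (P.image φ).card ≤ 2 * m := by
    calc (P.image φ).card
        ≤ (((Finset.Icc (-(m : ℤ)) m).erase 0).image
            fun n : ℤ => ((n / N : ℝ) : UnitAddCircle)).card := by
          refine Finset.card_le_card fun y hy => ?_
          obtain ⟨x, hx, rfl⟩ := Finset.mem_image.mp hy
          have hx0 : φ x ≠ 0 := by rw [hφ]; exact sub_ne_zero.mpr (hne x hx)
          have hxe : ‖φ x‖ ≤ ε := by rw [hφ]; exact hle x hx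
          have htor : N • φ x = 0 := by
            have := card_nsmul_eq_zero' (G := φ.range) (x := ⟨φ x, x, rfl⟩)
            exact congrArg Subtype.val this
          obtain ⟨s, hs⟩ := QuotientAddGroup.mk_surjective (φ x)
          have hs : (s : UnitAddCircle) = φ x := hs
          set t : ℝ := s - round s with ht
          have htφ : ((t : ℝ) : UnitAddCircle) = φ x := by
            rw [← hs, ht, AddCircle.coe_sub, sub_eq_self, AddCircle.coe_eq_zero_iff]
            exact ⟨round s, by simp⟩
          have htn : |t| ≤ ε := by
            rwa [ht, ← UnitAddCircle.norm_eq, hs]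
          rw [← htφ, ← AddCircle.coe_nsmul, AddCircle.coe_eq_zero_iff] at htor
          obtain ⟨n, hn⟩ := htor
          have hn : (n : ℝ) = N * t := by simpa using hn
          have htn' : t = n / N := by rw [hn]; field_simp
          refine Finset.mem_image.mpr ⟨n, ?_, by rw [← htφ, htn']⟩
          rw [Finset.mem_erase, Finset.mem_Icc, ← abs_le]
          constructor
          · rintro rfl
            apply hx0
            rw [← htφ, htn']; simp
          · have : n.natAbs ≤ m := by
              rw [hm]
              apply Nat.le_floor
              rw [Nat.cast_natAbs, Int.cast_abs, hn, abs_mul, abs_of_pos hN0', mul_comm]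
              gcongr
            rw [Int.abs_eq_natAbs]
            exact_mod_cast this
      _ ≤ ((Finset.Icc (-(m : ℤ)) m).erase 0).card := Finset.card_image_le
      _ = 2 * m := by
          rw [Finset.card_erase_of_mem (by simp), Int.card_Icc]
          omega
  calc (P.card : ℝ) ≤ ((Nat.card φ.ker * (P.image φ).card : ℕ) : ℝ) := by
        exact_mod_cast Finset.card_le_mul_card_image P _ hfib
    _ ≤ ((Nat.card φ.ker * (2 * m) : ℕ) : ℝ) := by
        exact_mod_cast Nat.mul_le_mul_left _ himg
    _ = Nat.card φ.ker * (2 * (m : ℝ)) := by push_cast; ring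
    _ ≤ Nat.card φ.ker * (2 * (ε * N)) := by
        gcongr
        exact Nat.floor_le (by positivity)
    _ = 2 * ε * ((Nat.card φ.ker * N : ℕ) : ℝ) := by push_cast; ring
    _ = 2 * ε * (q * r) := by rw [hNK]; push_cast; ring

/-! ### Weak convergence in `L²` and almost everywhere divergence -/

section WeakConvergence
open MeasureTheory AddCircle
open scoped InnerProductSpace ComplexConjugate

/-- For a bounded family in a Hilbert space, weak convergence to `0` can be tested on a set with
dense span. -/
theorem tendsto_inner_of_span_dense {ι H : Type*} [NormedAddCommGroup H] [InnerProductSpace ℂ H]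
    {l : Filter ι} {v : ι → H} {C : ℝ} (hC : ∀ᶠ n in l, ‖v n‖ ≤ C) {s : Set H}
    (hs : (Submodule.span ℂ s).topologicalClosure = ⊤)
    (h : ∀ e ∈ s, Tendsto (fun n => inner ℂ e (v n)) l (𝓝 0)) (y : H) :
    Tendsto (fun n => inner ℂ y (v n)) l (𝓝 0) := by
  have hspan : ∀ z ∈ Submodule.span ℂ s, Tendsto (fun n => inner ℂ z (v n)) l (𝓝 0) := by
    intro z hz
    induction hz using Submodule.span_induction with
    | mem e he => exact h e he
    | zero => simpa using tendsto_const_nhds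
    | add x y _ _ hx hy => simpa [inner_add_left] using hx.add hy
    | smul c x _ hx => simpa only [inner_smul_left, mul_zero] using hx.const_mul (conj c)
  rw [Metric.tendsto_nhds]
  intro ε hε
  have hy : y ∈ closure (Submodule.span ℂ s : Set H) := by
    rw [← Submodule.topologicalClosure_coe, hs]; trivial
  obtain ⟨z, hz, hyz⟩ := Metric.mem_closure_iff.mp hy (ε / (2 * (|C| + 1))) (by positivity)
  filter_upwards [hC, Metric.tendsto_nhds.mp (hspan z hz) (ε / 2) (by positivity)] with n h1 h2
  rw [dist_zero_right] at h2 ⊢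
  rw [dist_eq_norm] at hyz
  have h3 : ‖inner ℂ (y - z) (v n)‖ ≤ ε / 2 := by
    calc ‖inner ℂ (y - z) (v n)‖ ≤ ‖y - z‖ * ‖v n‖ := norm_inner_le_norm _ _
      _ ≤ (ε / (2 * (|C| + 1))) * (|C| + 1) := by
          gcongr
          exact h1.trans ((le_abs_self C).trans (by linarith))
      _ = ε / 2 := by field_simp
  calc ‖inner ℂ y (v n)‖ = ‖inner ℂ (y - z) (v n) + inner ℂ z (v n)‖ := by
        rw [← inner_add_left, sub_add_cancel]
    _ ≤ ‖inner ℂ (y - z) (v n)‖ + ‖inner ℂ z (v n)‖ := norm_add_le _ _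
    _ < ε := by linarith

theorem inner_toLp_toLp {X : Type*} [MeasurableSpace X] {μ : Measure X} {f g : X → ℂ}
    (hf : MemLp f 2 μ) (hg : MemLp g 2 μ) :
    inner ℂ (hf.toLp f) (hg.toLp g) = ∫ x, conj (f x) * g x ∂μ := by
  rw [L2.inner_def]
  refine integral_congr_ae ?_
  filter_upwards [hf.coeFn_toLp, hg.coeFn_toLp] with x h1 h2
  rw [h1, h2, RCLike.inner_apply']

/-- If the means of nonnegative functions `S n` on the circle tend to infinity, the nonzero Fourier
coefficients are of smaller order than the means, and infinitely often the second moment is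
at most a constant times the square of the mean, then `S n x` is unbounded in `n` for almost every
`x`. Along those `n`, the functions `S n / W n` converge weakly to `1` in `L²`; tested against the
indicator function of `{x | ∀ n, S n x ≤ M}`, where they tend uniformly to `0`, this shows that the
set is null. -/
theorem ae_forall_exists_lt_of_tendsto_fourier {S : ℕ → UnitAddCircle → ℝ} {W : ℕ → ℝ}
    (hSm : ∀ n, Measurable (S n)) (hS0 : ∀ n x, 0 ≤ S n x) (hSb : ∀ n, ∃ b, ∀ x, S n x ≤ b)
    (hW : Tendsto W atTop atTop) (hmean : ∀ n, ∫ x, S n x ∂haarAddCircle = W n)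
    (hF : ∀ h : ℤ, h ≠ 0 → Tendsto
      (fun n => (∫ x, (S n x : ℂ) * fourier h x ∂haarAddCircle) / (W n : ℂ)) atTop (𝓝 0))
    (hL2 : ∃ C : ℝ, ∃ᶠ n in atTop, ∫ x, S n x ^ 2 ∂haarAddCircle ≤ C * W n ^ 2) :
    ∀ᵐ x ∂(haarAddCircle : Measure UnitAddCircle), ∀ M : ℕ, ∃ n, (M : ℝ) < S n x := by
  rw [ae_all_iff]
  intro M
  obtain ⟨C, hC⟩ := hL2
  set μ : Measure UnitAddCircle := haarAddCircle with hμ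
  set B : Set UnitAddCircle := {x | ¬ ∃ n, (M : ℝ) < S n x} with hB
  have hBm : MeasurableSet B := by
    have : B = ⋂ n, {x | S n x ≤ M} := by ext x; simp [hB]
    rw [this]
    exact MeasurableSet.iInter fun n => measurableSet_le (hSm n) measurable_const
  have hint : ∀ n, Integrable (S n) μ := by
    intro n
    obtain ⟨b, hb⟩ := hSb n
    refine Integrable.of_bound (hSm n).aestronglyMeasurable b (Eventually.of_forall fun x => ?_)
    rw [Real.norm_of_nonneg (hS0 n x)]; exact hb x
  set f : ℕ → UnitAddCircle → ℂ := fun n x => ((S n x / W n : ℝ) : ℂ) with hf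
  have hfm : ∀ n, Measurable (f n) := fun n =>
    Complex.measurable_ofReal.comp ((hSm n).div_const _)
  have hfL : ∀ n, MemLp (f n) 2 μ := by
    intro n
    obtain ⟨b, hb⟩ := hSb n
    refine MemLp.of_bound (hfm n).aestronglyMeasurable (b / |W n|) (Eventually.of_forall fun x => ?_)
    rw [hf, Complex.norm_real, norm_div, Real.norm_of_nonneg (hS0 n x), Real.norm_eq_abs]
    gcongr
    exact hb x
  set g : UnitAddCircle → ℂ := B.indicator 1 with hg
  have hgL : MemLp g 2 μ := (memLp_const (1 : ℂ)).indicator hBm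
  set e : ℤ → Lp ℂ 2 μ := fun h => fourierLp 2 h with he
  set v : ℕ → Lp ℂ 2 μ := fun n => (hfL n).toLp (f n) - e 0 with hv
  -- the indices along which the second moment bound holds
  set l : Filter ℕ := atTop ⊓ 𝓟 {n | ∫ x, S n x ^ 2 ∂μ ≤ C * W n ^ 2} with hl
  have hlne : l.NeBot := frequently_mem_iff_neBot.mp hC
  have hle : l ≤ atTop := inf_le_left
  have hWpos : ∀ᶠ n in l, 0 < W n := hle (hW.eventually_gt_atTop 0)
  have hbd : ∀ᶠ n in l, ‖v n‖ ≤ √C + 1 := by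
    have hmem : ∀ᶠ n in l, ∫ x, S n x ^ 2 ∂μ ≤ C * W n ^ 2 :=
      mem_inf_of_right (mem_principal_self _)
    filter_upwards [hWpos, hmem] with n hn hn2
    have h1 : ‖(hfL n).toLp (f n)‖ ^ 2 = (∫ x, S n x ^ 2 ∂μ) / W n ^ 2 := by
      have h2 : ((‖(hfL n).toLp (f n)‖ ^ 2 : ℝ) : ℂ) = ((∫ x, S n x ^ 2 ∂μ) / W n ^ 2 : ℝ) := by
        push_cast
        rw [← Complex.ofReal_pow, ← Complex.ofReal_pow]
        refine (Complex.ofReal_pow _ _).trans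
          ((inner_self_eq_norm_sq_to_K (𝕜 := ℂ) ((hfL n).toLp (f n))).symm.trans ?_)
        rw [inner_toLp_toLp, ← Complex.ofReal_div, ← integral_div, ← integral_complex_ofReal]
        refine integral_congr_ae (Eventually.of_forall fun x => ?_)
        simp only [hf, Complex.conj_ofReal]
        push_cast; ring
      exact_mod_cast h2
    have h3 : ‖(hfL n).toLp (f n)‖ ≤ √C := by
      apply Real.le_sqrt_of_sq_le
      rw [h1, div_le_iff₀ (by positivity)]
      exact hn2
    have h4 : ‖e 0‖ = 1 := orthonormal_fourier.1 0
    calc ‖v n‖ ≤ ‖(hfL n).toLp (f n)‖ + ‖e 0‖ := norm_sub_le _ _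
      _ ≤ √C + 1 := by rw [h4]; gcongr
  have hinner_e : ∀ (h : ℤ) n, inner ℂ (e h) ((hfL n).toLp (f n)) =
      (∫ x, (S n x : ℂ) * fourier (-h) x ∂μ) / (W n : ℂ) := by
    intro h n
    rw [L2.inner_def, ← integral_div]
    refine integral_congr_ae ?_
    filter_upwards [coeFn_fourierLp (T := 1) 2 h, (hfL n).coeFn_toLp] with x h1 h2
    rw [h1, h2, RCLike.inner_apply', ← fourier_neg]
    simp only [hf]; push_cast; ring
  have hweak : ∀ y ∈ Set.range e, Tendsto (fun n => inner ℂ y (v n)) l (𝓝 0) := by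
    rintro _ ⟨h, rfl⟩
    simp only [hv, inner_sub_right, hinner_e]
    rcases eq_or_ne h 0 with rfl | hh
    · refine tendsto_const_nhds.congr' ?_
      filter_upwards [hWpos] with n hn
      have h4 : inner ℂ (e 0) (e 0) = 1 := by
        rw [inner_self_eq_norm_sq_to_K, orthonormal_fourier.1 0]; simp
      rw [h4]
      simp only [neg_zero, fourier_zero, mul_one]
      rw [integral_complex_ofReal, hmean n, div_self (by exact_mod_cast hn.ne'), sub_self]
    · have h4 : inner ℂ (e h) (e 0) = 0 := orthonormal_fourier.2 hh
      simp only [h4, sub_zero]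
      exact (hF (-h) (neg_ne_zero.mpr hh)).mono_left hle
  have hdense : (Submodule.span ℂ (Set.range e)).topologicalClosure = ⊤ :=
    span_fourierLp_closure_eq_top (by norm_num)
  have hlim := tendsto_inner_of_span_dense hbd hdense hweak (hgL.toLp g)
  have hg0 : inner ℂ (hgL.toLp g) (e 0) = ((μ.real B : ℝ) : ℂ) := by
    rw [L2.inner_def]
    have : ∀ᵐ x ∂μ, inner ℂ (hgL.toLp g x) (e 0 x) = B.indicator (fun _ => (1 : ℂ)) x := by
      filter_upwards [coeFn_fourierLp (T := 1) 2 0, hgL.coeFn_toLp] with x h1 h2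
      rw [h1, h2, RCLike.inner_apply', fourier_zero]
      by_cases hx : x ∈ B <;> simp [hg, hx]
    rw [integral_congr_ae this, integral_indicator hBm]
    simp [Measure.real]
  have hgf : ∀ n, inner ℂ (hgL.toLp g) ((hfL n).toLp (f n)) =
      (((∫ x in B, S n x ∂μ) / W n : ℝ) : ℂ) := by
    intro n
    rw [inner_toLp_toLp, ← integral_div, ← integral_complex_ofReal, ← integral_indicator hBm]
    refine integral_congr_ae (Eventually.of_forall fun x => ?_)
    by_cases hx : x ∈ B <;> simp [hg, hf, hx]
  have hzero : Tendsto (fun n => (∫ x in B, S n x ∂μ) / W n) l (𝓝 0) := by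
    refine squeeze_zero' (g := fun n => M / W n) ?_ ?_
      ((tendsto_const_nhds.div_atTop hW).mono_left hle)
    · filter_upwards [hWpos] with n hn
      exact div_nonneg (integral_nonneg fun x => hS0 n x) hn.le
    · filter_upwards [hWpos] with n hn
      gcongr
      calc ∫ x in B, S n x ∂μ ≤ ∫ _ in B, (M : ℝ) ∂μ :=
            setIntegral_mono_on (hint n).integrableOn (integrable_const _).integrableOn hBm
              fun x hx => by
                simp only [hB, Set.mem_ofPred_eq, not_exists, not_lt] at hx
                exact hx n
        _ = μ.real B * M := by simp
        _ ≤ 1 * M := by gcongr; exact measureReal_le_one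
        _ = M := one_mul _
  have hlim2 : Tendsto (fun n => inner ℂ (hgL.toLp g) (v n)) l (𝓝 (-((μ.real B : ℝ) : ℂ))) := by
    simp only [hv, inner_sub_right, hg0, hgf]
    have := ((Complex.continuous_ofReal.tendsto 0).comp hzero).sub_const ((μ.real B : ℝ) : ℂ)
    simpa using this
  have hfin : μ.real B = 0 := by
    have := tendsto_nhds_unique hlim hlim2
    simpa using this.symm
  rw [ae_iff]
  exact (measureReal_eq_zero_iff).mp hfin

end WeakConvergence

/-! ### First and second moments of counting functions -/

section Counting
open MeasureTheory AddCircle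

/-- The number of residues `u ∈ A` whose image `u / q` on the circle `ℝ / ℤ` lies within `ρ` of `x`,
as a real number. Counting with multiplicity, rather than taking the indicator function of a union
of arcs, makes the moments exact sums even when the arcs overlap. -/
noncomputable def nearCount {q : ℕ} [NeZero q] (A : Finset (ZMod q)) (ρ : ℝ)
    (x : UnitAddCircle) : ℝ :=
  ∑ u ∈ A, (Metric.closedBall (ZMod.toAddCircle u) ρ).indicator 1 x

variable {q r : ℕ} [NeZero q] [NeZero r]

theorem measurable_nearCount (A : Finset (ZMod q)) (ρ : ℝ) : Measurable (nearCount A ρ) :=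
  Finset.measurable_fun_sum _ fun _ _ =>
    measurable_one.indicator Metric.isClosed_closedBall.measurableSet

theorem nearCount_nonneg (A : Finset (ZMod q)) (ρ : ℝ) (x : UnitAddCircle) :
    0 ≤ nearCount A ρ x :=
  Finset.sum_nonneg fun _ _ => Set.indicator_nonneg (fun _ _ => zero_le_one) _

theorem nearCount_le_card (A : Finset (ZMod q)) (ρ : ℝ) (x : UnitAddCircle) :
    nearCount A ρ x ≤ A.card := by
  calc nearCount A ρ x ≤ ∑ _u ∈ A, (1 : ℝ) := Finset.sum_le_sum fun u _ =>
        Set.indicator_le' (fun _ _ => le_rfl) (fun _ _ => zero_le_one) x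
    _ = A.card := by simp

theorem exists_dist_le_of_nearCount_ne_zero {A : Finset (ZMod q)} {ρ : ℝ} {x : UnitAddCircle}
    (h : nearCount A ρ x ≠ 0) : ∃ u ∈ A, dist x (ZMod.toAddCircle u) ≤ ρ := by
  obtain ⟨u, hu, hux⟩ := Finset.exists_ne_zero_of_sum_ne_zero h
  exact ⟨u, hu, Metric.mem_closedBall.mp (Set.mem_of_indicator_ne_zero hux)⟩

theorem haarAddCircle_real_closedBall (x : UnitAddCircle) {ρ : ℝ} (hρ : 0 ≤ ρ) :
    (haarAddCircle : Measure UnitAddCircle).real (Metric.closedBall x ρ) = min 1 (2 * ρ) := by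
  have h : (volume : Measure UnitAddCircle) = haarAddCircle := by
    rw [volume_eq_smul_haarAddCircle]; simp
  rw [Measure.real, ← h, AddCircle.volume_closedBall, ENNReal.toReal_ofReal]
  positivity

theorem integrable_closedBall_indicator (x : UnitAddCircle) (ρ : ℝ) :
    Integrable ((Metric.closedBall x ρ).indicator (1 : UnitAddCircle → ℝ)) haarAddCircle :=
  (integrable_const (1 : ℝ)).indicator Metric.isClosed_closedBall.measurableSet

theorem integral_nearCount (A : Finset (ZMod q)) {ρ : ℝ} (hρ : 0 ≤ ρ) :
    ∫ x, nearCount A ρ x ∂haarAddCircle = A.card * min 1 (2 * ρ) := by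
  unfold nearCount
  rw [integral_finsetSum _ fun u _ => integrable_closedBall_indicator _ _]
  simp_rw [integral_indicator_one Metric.isClosed_closedBall.measurableSet,
    haarAddCircle_real_closedBall _ hρ]
  simp

theorem integrable_nearCount (A : Finset (ZMod q)) (ρ : ℝ) :
    Integrable (nearCount A ρ) haarAddCircle :=
  integrable_finsetSum _ fun _ _ => integrable_closedBall_indicator _ _

theorem fourier_toAddCircle (h : ℤ) (u : ZMod q) :
    fourier h (ZMod.toAddCircle u) = ZMod.stdAddChar ((h : ZMod q) * u) := by
  rw [fourier_apply, ← map_zsmul, zsmul_eq_mul]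
  rfl

/-- Each arc is a translate of the arc about `0`, so a Fourier coefficient of the counting function
is an exponential sum over `A` times a Fourier coefficient of one arc. -/
theorem norm_integral_nearCount_mul_fourier_le (A : Finset (ZMod q)) {ρ : ℝ} (hρ : 0 ≤ ρ)
    (h : ℤ) :
    ‖∫ x, (nearCount A ρ x : ℂ) * fourier h x ∂haarAddCircle‖ ≤
      ‖∑ u ∈ A, ZMod.stdAddChar ((h : ZMod q) * u)‖ * min 1 (2 * ρ) := by
  set I : ℂ := ∫ x in Metric.closedBall (0 : UnitAddCircle) ρ, fourier h x ∂haarAddCircle with hI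
  have hball : ∀ c : UnitAddCircle,
      ∫ x in Metric.closedBall c ρ, fourier h x ∂haarAddCircle = fourier h c * I := by
    intro c
    rw [hI, ← integral_indicator Metric.isClosed_closedBall.measurableSet,
      ← integral_indicator Metric.isClosed_closedBall.measurableSet, ← integral_const_mul,
      ← integral_add_right_eq_self _ c]
    refine integral_congr_ae (Eventually.of_forall fun x => ?_)
    by_cases hx : ‖x‖ ≤ ρ
    · simp [Set.indicator, hx, AddCircle.toCircle_add, mul_comm]
    · simp [Set.indicator, hx]
  have hsum : ∫ x, (nearCount A ρ x : ℂ) * fourier h x ∂haarAddCircle =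
      (∑ u ∈ A, ZMod.stdAddChar ((h : ZMod q) * u)) * I := by
    have h1 : ∀ x, (nearCount A ρ x : ℂ) * fourier h x =
        ∑ u ∈ A, (Metric.closedBall (ZMod.toAddCircle u) ρ).indicator (fun x => fourier h x) x := by
      intro x
      unfold nearCount
      push_cast
      rw [Finset.sum_mul]
      refine Finset.sum_congr rfl fun u _ => ?_
      by_cases hx : x ∈ Metric.closedBall (ZMod.toAddCircle u) ρ <;> simp [hx]
    simp_rw [h1]
    rw [integral_finsetSum _ fun u _ => ?_, Finset.sum_mul]
    · refine Finset.sum_congr rfl fun u _ => ?_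
      rw [integral_indicator Metric.isClosed_closedBall.measurableSet, hball, fourier_toAddCircle]
    · refine Integrable.indicator ?_ Metric.isClosed_closedBall.measurableSet
      exact (map_continuous (fourier h)).integrable_of_hasCompactSupport
        (HasCompactSupport.of_compactSpace _)
  rw [hsum, norm_mul]
  gcongr
  rw [← haarAddCircle_real_closedBall 0 hρ]
  calc ‖I‖ ≤ 1 * haarAddCircle.real (Metric.closedBall (0 : UnitAddCircle) ρ) :=
        norm_setIntegral_le_of_norm_le_const (measure_lt_top _ _) fun x _ => by
          rw [fourier_apply, Circle.norm_coe]
    _ = _ := one_mul _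

/-- The overlap estimate. Pairs of distinct centres contribute only if they are at distance at most
`ρ + σ`, and then at most `2 min(ρ, σ)` each; `(ρ + σ) min(ρ, σ) ≤ 2ρσ` makes their total a product
of a term in `q ρ` and a term in `r σ`. The last summand accounts for coincident centres. -/
theorem integral_nearCount_mul_nearCount_le (A : Finset (ZMod q)) (B : Finset (ZMod r))
    {ρ σ : ℝ} (hρ : 0 ≤ ρ) (hσ : 0 ≤ σ) :
    ∫ x, nearCount A ρ x * nearCount B σ x ∂haarAddCircle ≤
      8 * (q * ρ) * (r * σ) + 2 * ρ *
        ((A ×ˢ B).filter fun p => ZMod.toAddCircle p.1 = ZMod.toAddCircle p.2).card := by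
  classical
  set J : ZMod q × ZMod r → Set UnitAddCircle := fun p =>
    Metric.closedBall (ZMod.toAddCircle p.1) ρ ∩ Metric.closedBall (ZMod.toAddCircle p.2) σ with hJ
  have hJm : ∀ p, MeasurableSet (J p) := fun p =>
    Metric.isClosed_closedBall.measurableSet.inter Metric.isClosed_closedBall.measurableSet
  set m : ZMod q × ZMod r → ℝ := fun p => haarAddCircle.real (J p) with hm
  have hint : ∫ x, nearCount A ρ x * nearCount B σ x ∂haarAddCircle = ∑ p ∈ A ×ˢ B, m p := by
    have h1 : ∀ x, nearCount A ρ x * nearCount B σ x =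
        ∑ p ∈ A ×ˢ B, (J p).indicator (1 : UnitAddCircle → ℝ) x := by
      intro x
      unfold nearCount
      rw [Finset.sum_mul_sum, ← Finset.sum_product']
      refine Finset.sum_congr rfl fun p _ => ?_
      rw [hJ, Set.inter_indicator_one]; rfl
    simp_rw [h1]
    have h2 : ∀ p ∈ A ×ˢ B, Integrable ((J p).indicator (1 : UnitAddCircle → ℝ)) haarAddCircle :=
      fun p _ => (integrable_const (1 : ℝ)).indicator (hJm p)
    rw [integral_finsetSum _ h2]
    exact Finset.sum_congr rfl fun p _ => integral_indicator_one (hJm p)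
  have hm1 : ∀ p, m p ≤ 2 * min ρ σ := by
    intro p
    rw [mul_min_of_nonneg _ _ zero_le_two]
    refine le_min ?_ ?_
    · refine (measureReal_mono Set.inter_subset_left).trans ?_
      rw [haarAddCircle_real_closedBall _ hρ]; exact min_le_right _ _
    · refine (measureReal_mono Set.inter_subset_right).trans ?_
      rw [haarAddCircle_real_closedBall _ hσ]; exact min_le_right _ _
  rw [hint, ← Finset.sum_filter_add_sum_filter_not (A ×ˢ B)
    (fun p => ZMod.toAddCircle p.1 = ZMod.toAddCircle p.2), add_comm]
  refine add_le_add ?_ ?_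
  · set P := ((A ×ˢ B).filter fun p => ¬ ZMod.toAddCircle p.1 = ZMod.toAddCircle p.2).filter
      fun p => ‖ZMod.toAddCircle p.1 - ZMod.toAddCircle p.2‖ ≤ ρ + σ with hP
    have hcard : (P.card : ℝ) ≤ 2 * (ρ + σ) * (q * r) := by
      refine card_le_of_norm_toAddCircle_sub_le P (add_nonneg hρ hσ) (fun p hp => ?_) (fun p hp => ?_)
      · exact (Finset.mem_filter.mp (Finset.mem_filter.mp hp).1).2
      · exact (Finset.mem_filter.mp hp).2
    rw [← Finset.sum_subset (Finset.filter_subset _ _ : P ⊆ _)]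
    · calc ∑ p ∈ P, m p ≤ ∑ _p ∈ P, 2 * min ρ σ := Finset.sum_le_sum fun p _ => hm1 p
        _ = P.card * (2 * min ρ σ) := by rw [Finset.sum_const, nsmul_eq_mul]
        _ ≤ (2 * (ρ + σ) * (q * r)) * (2 * min ρ σ) := by gcongr
        _ = 4 * (q * r) * ((ρ + σ) * min ρ σ) := by ring
        _ ≤ 4 * (q * r) * (2 * (ρ * σ)) := by
            refine mul_le_mul_of_nonneg_left ?_ (by positivity)
            have h1 : ρ * min ρ σ ≤ ρ * σ := by gcongr; exact min_le_right _ _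
            have h2 : min ρ σ * σ ≤ ρ * σ := by gcongr; exact min_le_left _ _
            linarith
        _ = 8 * (q * ρ) * (r * σ) := by ring
    · intro p hp hpP
      have : J p = ∅ := by
        rw [hJ, ← Set.disjoint_iff_inter_eq_empty]
        refine Metric.closedBall_disjoint_closedBall ?_
        rw [dist_eq_norm]
        by_contra hlt
        exact hpP (Finset.mem_filter.mpr ⟨hp, not_lt.mp hlt⟩)
      simp [hm, this]
  · calc _ ≤ ∑ _p ∈ (A ×ˢ B).filter fun p => ZMod.toAddCircle p.1 = ZMod.toAddCircle p.2,
          2 * ρ := Finset.sum_le_sum fun p _ => (hm1 p).trans (by gcongr; exact min_le_left _ _)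
      _ = _ := by rw [Finset.sum_const, nsmul_eq_mul, mul_comm]

end Counting

/-! ### Passing between the circle and the line -/

section Transfer
open MeasureTheory AddCircle

theorem ae_coe_of_ae_haarAddCircle {p : UnitAddCircle → Prop}
    (h : ∀ᵐ x ∂(haarAddCircle : Measure UnitAddCircle), p x) : ∀ᵐ x : ℝ, p (x : UnitAddCircle) := by
  have hvol : (volume : Measure UnitAddCircle) = haarAddCircle := by
    rw [volume_eq_smul_haarAddCircle]; simp
  rw [← hvol] at h
  have h1 : ∀ n : ℤ, ∀ᵐ x : ℝ ∂volume.restrict (Set.Ioc (n : ℝ) (n + 1)), p (x : UnitAddCircle) :=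
    fun n => (UnitAddCircle.measurePreserving_mk n).quasiMeasurePreserving.ae h
  have h2 := (ae_restrict_iUnion_iff (μ := volume) (fun n : ℤ => Set.Ioc (n : ℝ) (n + 1))
    fun x => p (x : UnitAddCircle)).mpr h1
  rwa [iUnion_Ioc_intCast, Measure.restrict_univ] at h2

/-- The numerator `p ≡ u` for which `p / q` is nearest to `x` realizes the distance on the
circle. -/
theorem exists_int_abs_sub_div_eq {q : ℕ} [NeZero q] (x : ℝ) (u : ZMod q) :
    ∃ p : ℤ, (p : ZMod q) = u ∧
      |x - (p : ℝ) / (q : ℝ)| = ‖(x : UnitAddCircle) - ZMod.toAddCircle u‖ := by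
  obtain ⟨m, rfl⟩ := ZMod.intCast_surjective u
  have hq : (q : ℝ) ≠ 0 := NeZero.ne _
  refine ⟨m + q * round (x - m / q), by simp, ?_⟩
  rw [ZMod.toAddCircle_intCast, ← AddCircle.coe_sub, UnitAddCircle.norm_eq]
  congr 1
  push_cast
  field_simp
  ring

/-- Reduced fractions with different denominators are distinct modulo `1`. -/
theorem toAddCircle_unit_ne {q r : ℕ} [NeZero q] [NeZero r] (hqr : q ≠ r) (u : (ZMod q)ˣ)
    (v : (ZMod r)ˣ) : ZMod.toAddCircle (u : ZMod q) ≠ ZMod.toAddCircle (v : ZMod r) := by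
  have key : ∀ {q r : ℕ} [NeZero q] [NeZero r] (u : (ZMod q)ˣ) (v : (ZMod r)ˣ),
      ZMod.toAddCircle (u : ZMod q) = ZMod.toAddCircle (v : ZMod r) → r ∣ q := by
    intro q r _ _ u v h
    have h1 : ZMod.toAddCircle (q • (v : ZMod r)) = 0 := by
      rw [map_nsmul, ← h, ← map_nsmul, nsmul_eq_mul, ZMod.natCast_self, zero_mul, map_zero]
    rw [ZMod.toAddCircle_eq_zero, nsmul_eq_mul, Units.mul_left_eq_zero] at h1
    exact (ZMod.natCast_eq_zero_iff q r).mp h1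
  intro h
  exact hqr (Nat.dvd_antisymm (key v u h.symm) (key u v h))

end Transfer

/-! ### Divergence of the number of approximations -/

/-- The size hypothesis on the groups, freed of Euler's totient: their orders `N k` dominate the
square-root bound for exponential sums. -/
theorem tendsto_sqrt_div_card {q : ℕ → ℕ} (hq_pos : ∀ k, 0 < q k) {N : ℕ → ℝ}
    (hN : ∀ k, 0 < N k) {ε : ℝ} (hε : 0 < ε)
    (h : Tendsto (fun k => (Nat.totient (q k) : ℝ) / ((q k : ℝ) ^ ((1 : ℝ) / 2 - ε) * N k))
      atTop (𝓝 0)) :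
    Tendsto (fun k => √(q k) / N k) atTop (𝓝 0) := by
  obtain ⟨C, hC, hC'⟩ := exists_rpow_one_sub_le_mul_totient hε
  have h2 := h.const_mul C
  rw [mul_zero] at h2
  refine squeeze_zero (fun k => div_nonneg (Real.sqrt_nonneg _) (hN k).le) (fun k => ?_) h2
  have hq : (0 : ℝ) < q k := by exact_mod_cast hq_pos k
  have hp : (0 : ℝ) < (q k : ℝ) ^ ((1 : ℝ) / 2 - ε) := by positivity
  have h3 : √(q k) * (q k : ℝ) ^ ((1 : ℝ) / 2 - ε) = (q k : ℝ) ^ (1 - ε) := by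
    rw [Real.sqrt_eq_rpow, ← Real.rpow_add hq]; congr 1; ring
  have := hN k
  rw [mul_div_assoc', div_le_div_iff₀ this (by positivity), ← mul_assoc, h3]
  gcongr
  exact hC' _ (hq_pos k)

section Main
open MeasureTheory AddCircle

variable {q : ℕ → ℕ} [∀ k, NeZero (q k)]

theorem integral_nearCount_mul_nearCount_coset_le (hq : Function.Injective q) {α : ℕ → ℝ}
    (hα : ∀ k, 0 < α k) (a : ∀ k, (ZMod (q k))ˣ) (G : ∀ k, Subgroup (ZMod (q k))ˣ) (k l : ℕ) :
    ∫ x, nearCount (cosetResidues (a k) (G k)) (α k / (2 * q k)) x *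
        nearCount (cosetResidues (a l) (G l)) (α l / (2 * q l)) x ∂haarAddCircle ≤
      2 * (α k * α l) + if k = l then α k else 0 := by
  classical
  have hpos : ∀ k, (0 : ℝ) < q k := fun k => by exact_mod_cast NeZero.pos (q k)
  have hρ : ∀ k, 0 ≤ α k / (2 * q k) := fun k => by have := hα k; have := hpos k; positivity
  refine (integral_nearCount_mul_nearCount_le _ _ (hρ k) (hρ l)).trans (add_le_add (le_of_eq ?_) ?_)
  · have := (hpos k).ne'; have := (hpos l).ne'
    field_simp
    ring
  split_ifs with hkl
  · subst hkl
    have hcard : (((cosetResidues (a k) (G k) ×ˢ cosetResidues (a k) (G k)).filter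
        fun p => ZMod.toAddCircle p.1 = ZMod.toAddCircle p.2).card : ℝ) ≤ q k := by
      have h1 : ((cosetResidues (a k) (G k) ×ˢ cosetResidues (a k) (G k)).filter
        fun p => ZMod.toAddCircle p.1 = ZMod.toAddCircle p.2).card ≤
          (Finset.univ : Finset (ZMod (q k))).card := by
        refine Finset.card_le_card_of_injOn Prod.fst (fun _ _ => Finset.mem_coe.mpr (Finset.mem_univ _)) ?_
        intro x hx y hy hxy
        have hx' := ZMod.toAddCircle_inj.mp (Finset.mem_filter.mp hx).2
        have hy' := ZMod.toAddCircle_inj.mp (Finset.mem_filter.mp hy).2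
        exact Prod.ext hxy (by rw [← hx', ← hy']; exact hxy)
      rw [Finset.card_univ, ZMod.card] at h1
      exact_mod_cast h1
    calc _ ≤ 2 * (α k / (2 * q k)) * q k := by have := hρ k; gcongr
      _ = α k := by have := (hpos k).ne'; field_simp
  · rw [Finset.filter_false_of_mem, Finset.card_empty, Nat.cast_zero, mul_zero]
    rintro ⟨x, y⟩ hp
    obtain ⟨hx, hy⟩ := Finset.mem_product.mp hp
    obtain ⟨u, -, rfl⟩ := mem_cosetResidues.mp hx
    obtain ⟨v, -, rfl⟩ := mem_cosetResidues.mp hy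
    exact toAddCircle_unit_ne (hq.ne hkl) u v

/-- The second moment of the number of approximations is at most of the order of
`(∑ k < n, α k) ^ 2`. The density hypothesis makes the first moment of the order of
`∑ k < n, α k` for infinitely many `n`. -/
theorem integral_sum_nearCount_sq_le (hq : Function.Injective q) {α : ℕ → ℝ}
    (hα : ∀ k, 0 < α k) (a : ∀ k, (ZMod (q k))ˣ) (G : ∀ k, Subgroup (ZMod (q k))ˣ) (n : ℕ) :
    ∫ x, (∑ k ∈ Finset.range n, nearCount (cosetResidues (a k) (G k)) (α k / (2 * q k)) x) ^ 2
        ∂haarAddCircle ≤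
      2 * (∑ k ∈ Finset.range n, α k) ^ 2 + ∑ k ∈ Finset.range n, α k := by
  set F : ℕ → UnitAddCircle → ℝ := fun k =>
    nearCount (cosetResidues (a k) (G k)) (α k / (2 * q k)) with hF
  have hint : ∀ k l, Integrable (fun x => F k x * F l x) haarAddCircle := by
    intro k l
    refine (integrable_nearCount _ _).mul_bdd (c := (cosetResidues (a l) (G l)).card)
      (measurable_nearCount _ _).aestronglyMeasurable (Eventually.of_forall fun x => ?_)
    rw [Real.norm_of_nonneg (nearCount_nonneg _ _ _)]
    exact nearCount_le_card _ _ _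
  simp_rw [sq, Finset.sum_mul_sum]
  rw [integral_finsetSum _ fun k _ => integrable_finsetSum _ fun l _ => hint k l]
  simp_rw [integral_finsetSum _ fun l _ => hint _ l]
  calc _ ≤ ∑ k ∈ Finset.range n, ∑ l ∈ Finset.range n,
        (2 * (α k * α l) + if k = l then α k else 0) :=
        Finset.sum_le_sum fun k _ => Finset.sum_le_sum fun l _ =>
          integral_nearCount_mul_nearCount_coset_le hq hα a G k l
    _ = _ := by
        simp_rw [Finset.sum_add_distrib, ← Finset.mul_sum]
        congr 1
        refine Finset.sum_congr rfl fun k hk => ?_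
        rw [Finset.sum_ite_eq, if_pos hk]

/-- The arcs have radius `α k / (2 * q k)`, half of what is allowed, so that points of the closed
arcs satisfy the strict inequality. The hypothesis `hsmall` ensures that they do not wrap around
the circle. -/
theorem ae_forall_exists_lt_sum_nearCount (hq : Function.Injective q) {α : ℕ → ℝ}
    (hα : ∀ k, 0 < α k) (a : ∀ k, (ZMod (q k))ˣ) (G : ∀ k, Subgroup (ZMod (q k))ˣ)
    (hdiv : Tendsto (fun n : ℕ => ∑ k ∈ Finset.range n, α k) atTop atTop)
    {c : ℝ} (hc : 0 < c) (hdens : ∃ᶠ n : ℕ in atTop,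
      c * ∑ k ∈ Finset.range n, α k <
        ∑ k ∈ Finset.range n, α k * ((Nat.card (G k) : ℝ) / (q k : ℝ)))
    (hsize : Tendsto (fun k => √(q k) / (Nat.card (G k) : ℝ)) atTop (𝓝 0))
    (hsmall : ∀ᶠ k in atTop, α k ≤ q k) :
    ∀ᵐ x ∂(haarAddCircle : Measure UnitAddCircle), ∀ M : ℕ, ∃ n, (M : ℝ) <
      ∑ k ∈ Finset.range n, nearCount (cosetResidues (a k) (G k)) (α k / (2 * q k)) x := by
  have hpos : ∀ k, (0 : ℝ) < q k := fun k => by exact_mod_cast NeZero.pos (q k)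
  have hρ : ∀ k, 0 ≤ α k / (2 * q k) := fun k => by have := hα k; have := hpos k; positivity
  have hG : ∀ k, (0 : ℝ) < Nat.card (G k) := fun k => by exact_mod_cast Nat.card_pos
  set A : ℕ → ℝ := fun n => ∑ k ∈ Finset.range n, α k with hA
  set w : ℕ → ℝ := fun k => Nat.card (G k) * min 1 (2 * (α k / (2 * q k))) with hw
  set W : ℕ → ℝ := fun n => ∑ k ∈ Finset.range n, w k with hWdef
  have hw0 : ∀ k, 0 ≤ w k := fun k => by
    have := hρ k; have := hG k; simp only [hw]; positivity
  have hWmono : Monotone W := fun m n hmn =>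
    Finset.sum_le_sum_of_subset_of_nonneg (Finset.range_mono hmn) fun k _ _ => hw0 k
  -- `W` differs from the sum in the density hypothesis by an eventually constant amount
  obtain ⟨K, hK⟩ := eventually_atTop.mp hsmall
  have hwK : ∀ k, K ≤ k → w k = α k * ((Nat.card (G k) : ℝ) / (q k : ℝ)) := by
    intro k hk
    have h1 : 2 * (α k / (2 * q k)) = α k / q k := by have := (hpos k).ne'; field_simp
    simp only [hw]
    rw [h1, min_eq_right ((div_le_one (hpos k)).mpr (hK k hk))]
    ring
  obtain ⟨D, hD⟩ : ∃ D : ℝ, ∀ n, K ≤ n →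
      ∑ k ∈ Finset.range n, α k * ((Nat.card (G k) : ℝ) / (q k : ℝ)) = W n + D := by
    refine ⟨∑ k ∈ Finset.range K, α k * ((Nat.card (G k) : ℝ) / (q k : ℝ)) - W K, fun n hn => ?_⟩
    induction n, hn using Nat.le_induction with
    | base => ring
    | succ n hn ih =>
      simp only [hWdef, Finset.sum_range_succ] at ih ⊢
      rw [ih, hwK n hn]; ring
  have hfreq : ∃ᶠ n in atTop, c / 2 * A n ≤ W n ∧ 1 ≤ A n := by
    refine (hdens.and_eventually ((eventually_ge_atTop K).and
      ((hdiv.eventually_ge_atTop (2 * D / c)).and (hdiv.eventually_ge_atTop 1)))).mono ?_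
    rintro n ⟨h1, h2, h3, h4⟩
    refine ⟨?_, h4⟩
    rw [hD n h2] at h1
    rw [div_le_iff₀ hc] at h3
    simp only [hA] at *
    linarith
  have hWtop : Tendsto W atTop atTop := by
    refine tendsto_atTop_atTop_of_monotone hWmono fun b => ?_
    obtain ⟨n, ⟨h1, -⟩, h2⟩ := (hfreq.and_eventually (hdiv.eventually_ge_atTop (2 * b / c))).exists
    refine ⟨n, le_trans ?_ h1⟩
    rw [div_le_iff₀ hc] at h2
    simp only [hA] at *
    linarith
  have hmeas : ∀ n, Measurable fun x => ∑ k ∈ Finset.range n,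
      nearCount (cosetResidues (a k) (G k)) (α k / (2 * q k)) x := fun n =>
    Finset.measurable_fun_sum _ fun k _ => measurable_nearCount _ _
  refine ae_forall_exists_lt_of_tendsto_fourier (W := W) hmeas
    (fun n x => Finset.sum_nonneg fun k _ => nearCount_nonneg _ _ _)
    (fun n => ⟨∑ k ∈ Finset.range n, ((cosetResidues (a k) (G k)).card : ℝ), fun x =>
      Finset.sum_le_sum fun k _ => nearCount_le_card _ _ _⟩) hWtop ?_ ?_ ?_
  · intro n
    rw [integral_finsetSum _ fun k _ => integrable_nearCount _ _]
    refine Finset.sum_congr rfl fun k _ => ?_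
    rw [integral_nearCount _ (hρ k), card_cosetResidues]
  · intro h hh
    have hlittle : (fun k => √|(h : ℝ)| * (√(q k) / Nat.card (G k)) * w k) =o[atTop] w := by
      have h1 : (fun k => √|(h : ℝ)| * (√(q k) / Nat.card (G k))) =o[atTop]
          (fun _ => (1 : ℝ)) := by
        rw [Asymptotics.isLittleO_one_iff]
        simpa using hsize.const_mul √|(h : ℝ)|
      simpa using h1.mul_isBigO (Asymptotics.isBigO_refl w atTop)
    -- a weighted average, with weights `w` of divergent sum, of a sequence tending to `0`
    have hsum := hlittle.sum_range hw0 hWtop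
    rw [Asymptotics.isLittleO_iff_tendsto' (by
      filter_upwards [hWtop.eventually_gt_atTop 0] with n hn h0
      exact absurd h0 hn.ne')] at hsum
    refine squeeze_zero_norm' ?_ hsum
    filter_upwards [hWtop.eventually_gt_atTop 0] with n hn
    rw [norm_div, Complex.norm_real, Real.norm_of_nonneg hn.le]
    gcongr
    have hfc : Continuous (fourier h : UnitAddCircle → ℂ) := map_continuous _
    have hint : ∀ k ∈ Finset.range n, Integrable (fun x =>
        (nearCount (cosetResidues (a k) (G k)) (α k / (2 * q k)) x : ℂ) * fourier h x)
        haarAddCircle := fun k _ => by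
      refine (integrable_nearCount _ _).ofReal.mul_bdd (c := 1)
        hfc.aestronglyMeasurable (Eventually.of_forall fun x => ?_)
      rw [fourier_apply, Circle.norm_coe]
    push_cast
    simp_rw [Finset.sum_mul]
    rw [integral_finsetSum _ hint]
    refine (norm_sum_le _ _).trans (Finset.sum_le_sum fun k _ => ?_)
    refine (norm_integral_nearCount_mul_fourier_le _ (hρ k) h).trans ?_
    have hS := Real.le_sqrt_of_sq_le (norm_sq_sum_cosetResidues_le (a k) (G k) hh)
    rw [Real.sqrt_mul (abs_nonneg _)] at hS
    calc _ ≤ √|(h : ℝ)| * √(q k) * min 1 (2 * (α k / (2 * q k))) := by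
          have := hρ k; gcongr
      _ = _ := by
          have := (hG k).ne'
          simp only [hw]; field_simp
  · refine ⟨3 * (2 / c) ^ 2, hfreq.mono ?_⟩
    rintro n ⟨h1, h2⟩
    refine (integral_sum_nearCount_sq_le hq hα a G n).trans ?_
    have h3 : A n ≤ 2 / c * W n := by
      calc A n = 2 / c * (c / 2 * A n) := by field_simp
        _ ≤ _ := by gcongr
    calc 2 * A n ^ 2 + A n ≤ 3 * A n ^ 2 := by nlinarith
      _ ≤ 3 * (2 / c * W n) ^ 2 := by gcongr
      _ = _ := by ring

end Main

theorem theorem2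
    (q : ℕ → ℕ) (hq_pos : ∀ k, 0 < q k) (hq_mono : StrictMono q)
    (α : ℕ → ℝ) (hα_pos : ∀ k, 0 < α k)
    (a : ∀ k, (ZMod (q k))ˣ) (G : ∀ k, Subgroup (ZMod (q k))ˣ)
    (hdiv : Tendsto (fun n : ℕ => ∑ k ∈ Finset.range n, α k) atTop atTop)
    (hdens : ∃ c : ℝ, 0 < c ∧ ∃ᶠ n : ℕ in atTop,
      c * ∑ k ∈ Finset.range n, α k <
        ∑ k ∈ Finset.range n, α k * ((Nat.card (G k) : ℝ) / (q k : ℝ)))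
    (hsize : ∃ ε : ℝ, 0 < ε ∧
      Tendsto
        (fun k : ℕ => (Nat.totient (q k) : ℝ) /
          ((q k : ℝ) ^ ((1 : ℝ) / 2 - ε) * (Nat.card (G k) : ℝ)))
        atTop (𝓝 0)) :
    ∀ᵐ x : ℝ ∂MeasureTheory.volume,
      {k : ℕ | ∃ p : ℤ, IsCoprime p (q k : ℤ) ∧
        |x - (p : ℝ) / (q k : ℝ)| < α k / (q k : ℝ) ∧
        ∃ u ∈ a k • (G k : Set (ZMod (q k))ˣ), (u : ZMod (q k)) = (p : ZMod (q k))}.Infinite := by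
  have : ∀ k, NeZero (q k) := fun k => ⟨(hq_pos k).ne'⟩
  have hpos : ∀ k, (0 : ℝ) < q k := fun k => by exact_mod_cast hq_pos k
  obtain ⟨c, hc, hdens⟩ := hdens
  obtain ⟨ε, hε, hsize⟩ := hsize
  have hsqrt := tendsto_sqrt_div_card hq_pos (fun k => by exact_mod_cast Nat.card_pos) hε hsize
  have hsol : ∀ (x : ℝ) (k : ℕ), ∀ u ∈ a k • (G k : Set (ZMod (q k))ˣ),
      ‖(x : UnitAddCircle) - ZMod.toAddCircle (u : ZMod (q k))‖ < α k / q k →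
      ∃ p : ℤ, IsCoprime p (q k : ℤ) ∧ |x - (p : ℝ) / (q k : ℝ)| < α k / (q k : ℝ) ∧
        ∃ u ∈ a k • (G k : Set (ZMod (q k))ˣ), (u : ZMod (q k)) = (p : ZMod (q k)) := by
    intro x k u hu hux
    obtain ⟨p, hp, hpx⟩ := exists_int_abs_sub_div_eq x (u : ZMod (q k))
    refine ⟨p, ?_, hpx ▸ hux, u, hu, hp.symm⟩
    exact ((ZMod.coe_int_isUnit_iff_isCoprime p (q k)).mp (hp ▸ u.isUnit)).symm
  by_cases hsmall : ∀ᶠ k in atTop, α k ≤ q k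
  · have hae := ae_coe_of_ae_haarAddCircle
      (ae_forall_exists_lt_sum_nearCount hq_mono.injective hα_pos a G hdiv hc hdens hsqrt hsmall)
    filter_upwards [hae] with x hx
    by_contra hfin
    rw [Set.not_infinite] at hfin
    set F : ℕ → ℝ := fun k =>
      nearCount (cosetResidues (a k) (G k)) (α k / (2 * q k)) (x : UnitAddCircle) with hF
    have hF0 : ∀ k, 0 ≤ F k := fun k => nearCount_nonneg _ _ _
    have hsupp : ∀ k, k ∉ hfin.toFinset → F k = 0 := by
      intro k hk
      by_contra hne
      obtain ⟨y, hy, hyx⟩ := exists_dist_le_of_nearCount_ne_zero hne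
      obtain ⟨u, hu, rfl⟩ := mem_cosetResidues.mp hy
      refine hk (hfin.mem_toFinset.mpr (hsol x k u hu ?_))
      rw [← dist_eq_norm]
      refine hyx.trans_lt ?_
      rw [mul_comm, ← div_div]
      exact half_lt_self (div_pos (hα_pos k) (hpos k))
    obtain ⟨M, hM⟩ := exists_nat_ge (∑ k ∈ hfin.toFinset, F k)
    obtain ⟨n, hn⟩ := hx M
    have hle : ∑ k ∈ Finset.range n, F k ≤ ∑ k ∈ hfin.toFinset, F k :=
      calc _ ≤ ∑ k ∈ Finset.range n ∪ hfin.toFinset, F k :=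
            Finset.sum_le_sum_of_subset_of_nonneg Finset.subset_union_left fun k _ _ => hF0 k
        _ = _ := (Finset.sum_subset Finset.subset_union_right fun k _ hk => hsupp k hk).symm
    exact absurd (hn.trans_le hle) (not_lt.mpr hM)
  -- when `q k < α k`, every `x` is within `1 / 2 < α k / q k` of each class of fractions
  · refine Eventually.of_forall fun x => ?_
    rw [← Nat.frequently_atTop_iff_infinite]
    refine (not_eventually.mp hsmall).mono fun k hk => ?_
    refine hsol x k (a k) (Set.mem_smul_set.mpr ⟨1, (G k).one_mem, mul_one _⟩) ?_
    have h1 := AddCircle.norm_le_half_period (p := 1)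
      (x := (x : UnitAddCircle) - ZMod.toAddCircle (a k : ZMod (q k))) one_ne_zero
    rw [abs_one] at h1
    have h2 : 1 < α k / q k := (one_lt_div (hpos k)).mpr (not_le.mp hk)
    linarith
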